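/- Let $d\in\mathbb{N}$, $d\ge 1$, and $q\in[1,\infty]$. Let $\mathbb{D}_d:=\{(a,b)\in[0,1]^d\times[0,1]^d : a_j\le b_j \text{ for } j=1,\dots,d\}$. For $c\in L_q(\mathbb{D}_d)$ (real-valued, with respect to Lebesgue measure) define $$(T_dc)(x):=\int_{\mathbb{D}_d}c(a,b)\,\prod_{j=1}^d\mathbf{1}_{[a_j,b_j)}(x_j)\,\mathrm{d}(a,b),\qquad x\in[0,1]^d.$$ Let $F_{d,q}:=\{T_dc : c\in L_q(\mathbb{D}_d)\}$ (a space of functions on $[0,1]^d$), and for $f\in F_{d,q}$ let $$\|f\|_{\rm box}:=\inf\{\|c\|_{L_q(\mathbb{D}_d)} : c\in L_q(\mathbb{D}_d),\ f=T_dc\}.$$ Then every $f\in F_{d,q}$ has a weak mixed derivative $Df=\partial_1\cdots\partial_d f$ on $(0,1)^d$ (that is, a locally integrable function $g$ with $\int_{(0,1)^d} f\,\partial_1\cdots\partial_d\varphi\,\mathrm{d}x=(-1)^d\int_{(0,1)^d} g\,\varphi\,\mathrm{d}x$ for all smooth $\varphi$ with compact support in $(0,1)^d$), it belongs to $L_q([0,1]^d)$,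 and with $\|f\|_{\rm mix}:=\|Df\|_{L_q([0,1]^d)}$ we have $$2^{-d}\,\|f\|_{\rm mix}\le\|f\|_{\rm box}\le 2^d\,\|f\|_{\rm mix}.$$ Moreover, if $q=2$, then $\|f\|_{\rm box}=\|f\|_{\rm mix}$ for all $f\in F_{d,2}$. -/

import Mathlib

open MeasureTheory Set
open scoped ENNReal ContDiff

noncomputable section

/-- The parameter domain `𝔻_d` of all pairs `(a, b)` with `0 ≤ a_j ≤ b_j ≤ 1` for every `j`. -/
def boxDomain (d : ℕ) : Set ((Fin d → ℝ) × (Fin d → ℝ)) :=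
  {p | ∀ j, 0 ≤ p.1 j ∧ p.1 j ≤ p.2 j ∧ p.2 j ≤ 1}

/-- The closed unit cube `[0,1]^d`. -/
def unitCube (d : ℕ) : Set (Fin d → ℝ) := {x | ∀ j, x j ∈ Icc (0 : ℝ) 1}

/-- The open unit cube `(0,1)^d`. -/
def openCube (d : ℕ) : Set (Fin d → ℝ) := {x | ∀ j, x j ∈ Ioo (0 : ℝ) 1}

/-- The indicator function of the box with corners `a`, `b`, evaluated at `x`:
the product over `j` of the indicator of `[a_j, b_j)` at `x_j`. -/
def boxIndicator {d : ℕ} (a b x : Fin d → ℝ) : ℝ :=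
  ∏ j, (Ico (a j) (b j)).indicator (fun _ => (1 : ℝ)) (x j)

/-- The operator `T_d`. -/
def boxOperator (d : ℕ) (c : (Fin d → ℝ) × (Fin d → ℝ) → ℝ) (x : Fin d → ℝ) : ℝ :=
  ∫ p in boxDomain d, c p * boxIndicator p.1 p.2 x

/-- `c` is a representer of `f`: it lies in `L_q(𝔻_d)` and `f = T_d c` on `[0,1]^d`. -/
def IsRepresenter (d : ℕ) (q : ℝ≥0∞) (f : (Fin d → ℝ) → ℝ)
    (c : (Fin d → ℝ) × (Fin d → ℝ) → ℝ) : Prop :=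
  MemLp c q (volume.restrict (boxDomain d)) ∧ EqOn f (boxOperator d c) (unitCube d)

/-- The space `F_{d,q}`. Its elements are functions on `[0,1]^d`; here they are functions on
`ℝ^d` of which only the values on `[0,1]^d` matter. -/
def boxSpace (d : ℕ) (q : ℝ≥0∞) : Set ((Fin d → ℝ) → ℝ) :=
  {f | ∃ c, IsRepresenter d q f c}

/-- The box norm: the infimum of `‖c‖_{L_q(𝔻_d)}` over all representers `c` of `f`. -/
def boxNorm (d : ℕ) (q : ℝ≥0∞) (f : (Fin d → ℝ) → ℝ) : ℝ :=
  sInf {r | ∃ c, IsRepresenter d q f c ∧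
    r = (eLpNorm c q (volume.restrict (boxDomain d))).toReal}

/-- The classical partial derivative `∂_j φ`. -/
def partialD {d : ℕ} (j : Fin d) (φ : (Fin d → ℝ) → ℝ) (x : Fin d → ℝ) : ℝ :=
  fderiv ℝ φ x (Pi.single j 1)

/-- The classical mixed derivative `∂_1 ⋯ ∂_d φ`, each variable being differentiated once. -/
def classicalMixedD {d : ℕ} (φ : (Fin d → ℝ) → ℝ) : (Fin d → ℝ) → ℝ :=
  (List.finRange d).foldr partialD φ

/-- `g` is a weak mixed derivative `∂_1 ⋯ ∂_d f` of `f` on `(0,1)^d`: both are locally integrable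
there and `∫ f ∂_1 ⋯ ∂_d φ = (-1)^d ∫ g φ` for all smooth `φ` with compact support in `(0,1)^d`. -/
def IsWeakMixedDeriv (d : ℕ) (f g : (Fin d → ℝ) → ℝ) : Prop :=
  LocallyIntegrableOn f (openCube d) ∧ LocallyIntegrableOn g (openCube d) ∧
    ∀ φ : (Fin d → ℝ) → ℝ, ContDiff ℝ ∞ φ → HasCompactSupport φ → tsupport φ ⊆ openCube d →
      ∫ x in openCube d, f x * classicalMixedD φ x
        = (-1 : ℝ) ^ d * ∫ x in openCube d, g x * φ x

open Classical in
/-- The weak mixed derivative `D f = ∂_1 ⋯ ∂_d f`. It is unique up to a null set of `(0,1)^d`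
whenever it exists; the value is `0` if `f` has no weak mixed derivative. -/
def weakMixedDeriv (d : ℕ) (f : (Fin d → ℝ) → ℝ) : (Fin d → ℝ) → ℝ :=
  if h : ∃ g, IsWeakMixedDeriv d f g then h.choose else 0

/-- The mixed Sobolev norm `‖D f‖_{L_q([0,1]^d)}`. -/
def mixNorm (d : ℕ) (q : ℝ≥0∞) (f : (Fin d → ℝ) → ℝ) : ℝ :=
  (eLpNorm (weakMixedDeriv d f) q (volume.restrict (unitCube d))).toReal

end

/-!
The proof identifies the transpose of the map `c ↦ D (T_d c)` and shows that it preserves the `L_2`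
pairing with functions in the range of that map.

Exchanging `a_j` and `b_j` for the coordinates in a set defines `2^d` measure-preserving involutions
of the product of two unit cubes, and the images of the parameter domain tile this product up to
null sets (`sum_indicator_orderedPairs_swapCoords`). Let `c̃` be the antisymmetric extension of `c`
under these swaps and put `g(t) = ∫ c̃(t, u) du` (`boxDensity`). Since a swap can be moved from one
factor of a pairing to the other, `∫ g h = ∫ c · Δh` for every test function `h`, where `Δh (a, b)`
is the mixed difference of `h` over the box with corners `a` and `b` (`integral_boxDensity_mul`). The
indicator of `[a, b)` at `x` is the mixed difference of the indicator of the orthant below `x`,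
so `T_d c (x) = ∫_{[0,x]} g`. Fubini's theorem and the iterated fundamental theorem of calculus for
test functions (`integral_Ici_classicalMixedD`) then show that `g` is the weak mixed derivative of
`T_d c`.

The central identity is `∫ Δg · Δh = ∫ g h` for such densities `g`
(`integral_mixedDiff_mul_mixedDiff`). Expanding `Δh` gives one term for each swap; the trivial swap
contributes the right-hand side, and any other swap pairs `g` with a function that ignores some
coordinate, whose mixed difference is zero. Applied to indicators of orthants the identity says
that `Δg` is again a representer of `T_d c`.

Both `Δ` and `c ↦ g` are sums of `2^d` terms, each a contraction on `L_q` because swaps preserve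
measure and averaging is a conditional expectation. This yields the two inequalities. For `q = 2`
the identity gives `‖Δg‖ = ‖g‖` and `⟨c, Δg⟩ = ‖g‖²`, hence `‖c‖² - ‖g‖² = ‖c - Δg‖² ≥ 0`: the
representer `Δg` attains the infimum, and its norm is the norm of the mixed derivative.
-/

section

variable {d : ℕ}

/-! ### The measure on the cube and the coordinate swaps -/

/-- Lebesgue measure on the unit cube, a probability measure. -/
noncomputable def cubeMeasure (d : ℕ) : Measure (Fin d → ℝ) := volume.restrict (unitCube d)

/-- The pairs `(a, b)` with `a_j ≤ b_j` for every `j`. -/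
def orderedPairs (d : ℕ) : Set ((Fin d → ℝ) × (Fin d → ℝ)) := {p | p.1 ≤ p.2}

/-- The map exchanging `a_j` and `b_j` in the pair `(a, b)` for the coordinates `j` marked by `ε`. -/
def swapCoords (ε : Fin d → Bool) (p : (Fin d → ℝ) × (Fin d → ℝ)) :
    (Fin d → ℝ) × (Fin d → ℝ) :=
  (fun j => if ε j then p.2 j else p.1 j, fun j => if ε j then p.1 j else p.2 j)

/-- The sign `(-1)^k` of an exchange of `k` coordinates. -/
def swapSign (ε : Fin d → Bool) : ℝ := ∏ j, if ε j then -1 else 1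

lemma unitCube_eq_pi : unitCube d = univ.pi fun _ => Icc (0 : ℝ) 1 := by
  ext x; simp [unitCube, -pi_univ_Icc]

lemma openCube_eq_pi : openCube d = univ.pi fun _ => Ioo (0 : ℝ) 1 := by
  ext x; simp [openCube]

lemma measurableSet_unitCube : MeasurableSet (unitCube d) := by
  rw [unitCube_eq_pi]; exact MeasurableSet.univ_pi fun _ => measurableSet_Icc

lemma isOpen_openCube : IsOpen (openCube d) := by
  rw [openCube_eq_pi]; exact isOpen_set_pi finite_univ fun _ _ => isOpen_Ioo

lemma cubeMeasure_eq_pi :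
    cubeMeasure d = Measure.pi fun _ => (volume : Measure ℝ).restrict (Icc 0 1) := by
  rw [cubeMeasure, unitCube_eq_pi, volume_pi, Measure.restrict_pi_pi]

lemma cubeMeasure_eq_openCube : cubeMeasure d = volume.restrict (openCube d) := by
  rw [cubeMeasure]
  refine Measure.restrict_congr_set ?_
  rw [unitCube_eq_pi, openCube_eq_pi, volume_pi]
  exact Measure.pi_Ioo_ae_eq_pi_Icc.symm

instance : IsProbabilityMeasure (cubeMeasure d) := by
  have : IsProbabilityMeasure ((volume : Measure ℝ).restrict (Icc 0 1)) := ⟨by simp⟩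
  rw [cubeMeasure_eq_pi]
  infer_instance

lemma measurableSet_orderedPairs : MeasurableSet (orderedPairs d) :=
  (isClosed_le continuous_fst continuous_snd).measurableSet

lemma volume_restrict_boxDomain :
    (volume : Measure ((Fin d → ℝ) × (Fin d → ℝ))).restrict (boxDomain d) =
      ((cubeMeasure d).prod (cubeMeasure d)).restrict (orderedPairs d) := by
  rw [cubeMeasure, Measure.prod_restrict, Measure.restrict_restrict measurableSet_orderedPairs,
    ← Measure.volume_eq_prod]
  congr 1
  ext p
  simp only [boxDomain, orderedPairs, unitCube, mem_ofPred_eq, mem_inter_iff, mem_prod, mem_Icc,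
    Pi.le_def]
  constructor
  · intro h
    exact ⟨fun j => (h j).2.1, fun j => ⟨(h j).1, (h j).2.1.trans (h j).2.2⟩,
      fun j => ⟨(h j).1.trans (h j).2.1, (h j).2.2⟩⟩
  · rintro ⟨h, h1, h2⟩ j
    exact ⟨(h1 j).1, h j, (h2 j).2⟩

lemma swapCoords_swapCoords (ε δ : Fin d → Bool) (p : (Fin d → ℝ) × (Fin d → ℝ)) :
    swapCoords ε (swapCoords δ p) = swapCoords (fun j => xor (ε j) (δ j)) p := by
  ext j <;> cases hε : ε j <;> cases hδ : δ j <;> simp [swapCoords, hε, hδ]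

lemma swapCoords_false (p : (Fin d → ℝ) × (Fin d → ℝ)) : swapCoords (fun _ => false) p = p := by
  simp [swapCoords]

lemma swapCoords_self (ε : Fin d → Bool) (p : (Fin d → ℝ) × (Fin d → ℝ)) :
    swapCoords ε (swapCoords ε p) = p := by
  simp [swapCoords_swapCoords, swapCoords_false]

lemma swapSign_xor (ε δ : Fin d → Bool) :
    swapSign (fun j => xor (ε j) (δ j)) = swapSign ε * swapSign δ := by
  rw [swapSign, swapSign, swapSign, ← Finset.prod_mul_distrib]
  refine Finset.prod_congr rfl fun j _ => ?_
  cases ε j <;> cases δ j <;> simp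

lemma swapSign_false : swapSign (fun _ : Fin d => false) = 1 := by simp [swapSign]

lemma abs_swapSign (ε : Fin d → Bool) : |swapSign ε| = 1 := by
  rw [swapSign, Finset.abs_prod]
  exact Finset.prod_eq_one fun j _ => by split_ifs <;> simp

lemma swapSign_mul_self (ε : Fin d → Bool) : swapSign ε * swapSign ε = 1 := by
  rw [← abs_mul_abs_self, abs_swapSign, one_mul]

lemma measurePreserving_swapCoords (ε : Fin d → Bool) :
    MeasurePreserving (swapCoords ε) ((cubeMeasure d).prod (cubeMeasure d))
      ((cubeMeasure d).prod (cubeMeasure d)) := by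
  set ν : Measure ℝ := (volume : Measure ℝ).restrict (Icc 0 1)
  have e := measurePreserving_arrowProdEquivProdArrow ℝ ℝ (Fin d) (fun _ => ν) (fun _ => ν)
  have h : MeasurePreserving
      (fun (a : Fin d → ℝ × ℝ) j => (if ε j then Prod.swap else id) (a j))
      (Measure.pi fun _ => ν.prod ν) (Measure.pi fun _ => ν.prod ν) := by
    refine measurePreserving_pi _ _ fun j => ?_
    cases ε j
    · exact MeasurePreserving.id _
    · exact Measure.measurePreserving_swap
  rw [cubeMeasure_eq_pi]
  convert! (e.comp h).comp (e.symm _) using 1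
  ext p j
  · simp only [swapCoords, Function.comp, MeasurableEquiv.arrowProdEquivProdArrow]
    cases hε : ε j <;> simp [hε]
  · simp only [swapCoords, Function.comp, MeasurableEquiv.arrowProdEquivProdArrow]
    cases hε : ε j <;> simp [hε]

/-- A swap is an involution, so it may be moved from one factor of an integral to the other. -/
lemma integral_swapCoords (ε : Fin d → Bool) (F : (Fin d → ℝ) × (Fin d → ℝ) → ℝ) :
    ∫ p, F (swapCoords ε p) ∂(cubeMeasure d).prod (cubeMeasure d) =
      ∫ p, F p ∂(cubeMeasure d).prod (cubeMeasure d) := by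
  have hm := (measurePreserving_swapCoords ε).measurable
  let e : ((Fin d → ℝ) × (Fin d → ℝ)) ≃ᵐ ((Fin d → ℝ) × (Fin d → ℝ)) :=
    ⟨⟨swapCoords ε, swapCoords ε, swapCoords_self ε, swapCoords_self ε⟩, hm, hm⟩
  exact (measurePreserving_swapCoords ε).integral_comp e.measurableEmbedding F

/-- The images of the ordered pairs under the `2^d` swaps tile the product of two cubes. -/
lemma sum_indicator_orderedPairs_swapCoords :
    ∀ᵐ p ∂(cubeMeasure d).prod (cubeMeasure d),
      ∑ ε, (orderedPairs d).indicator (fun _ => (1 : ℝ)) (swapCoords ε p) = 1 := by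
  have hne : ∀ j : Fin d, ∀ᵐ p ∂(cubeMeasure d).prod (cubeMeasure d), p.1 j ≠ p.2 j := by
    intro j
    refine Measure.ae_prod_iff_ae_ae ?_ |>.2 (.of_forall fun a => ?_)
    · exact (measurableSet_eq_fun (by fun_prop) (by fun_prop)).compl
    · rw [cubeMeasure]
      refine ae_restrict_of_ae ?_
      have := Measure.pi_hyperplane (fun _ : Fin d => (volume : Measure ℝ)) j (a j)
      rw [ae_iff, volume_pi]
      convert this using 3
      ext x; simp [eq_comm]
  filter_upwards [ae_all_iff.2 hne] with p hp
  have h (ε : Fin d → Bool) : (orderedPairs d).indicator (fun _ => (1 : ℝ)) (swapCoords ε p) =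
      ∏ j, if ε j then (if p.2 j ≤ p.1 j then 1 else 0) else (if p.1 j ≤ p.2 j then 1 else 0) := by
    by_cases hm : swapCoords ε p ∈ orderedPairs d
    · rw [indicator_of_mem hm, Finset.prod_eq_one]
      intro j _
      have := hm j
      cases hε : ε j <;> simp_all [swapCoords]
    · rw [indicator_of_notMem hm]
      simp only [orderedPairs, mem_ofPred_eq, Pi.le_def, not_forall] at hm
      obtain ⟨j, hj⟩ := hm
      refine (Finset.prod_eq_zero (Finset.mem_univ j) ?_).symm
      cases hε : ε j <;> simp_all [swapCoords]
  simp_rw [h]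
  rw [← Fintype.prod_sum (fun j (e : Bool) => if e then (if p.2 j ≤ p.1 j then (1 : ℝ) else 0)
    else (if p.1 j ≤ p.2 j then 1 else 0))]
  refine Finset.prod_eq_one fun j _ => ?_
  rcases lt_or_gt_of_ne (hp j) with hj | hj
  · simp [hj.le, hj.not_ge]
  · simp [hj.le, hj.not_ge]

/-! ### Alternating sums over swaps -/

lemma integrable_mul_of_memLp {α : Type*} [MeasurableSpace α] {μ : Measure α} {p q : ℝ≥0∞}
    [p.HolderConjugate q] {F G : α → ℝ} (hF : MemLp F p μ) (hG : MemLp G q μ) :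
    Integrable (fun z => F z * G z) μ :=
  hF.integrable_mul hG

/-- The alternating sum of `F` over all `2^d` coordinate swaps. -/
def alternation (F : (Fin d → ℝ) × (Fin d → ℝ) → ℝ) (p : (Fin d → ℝ) × (Fin d → ℝ)) : ℝ :=
  ∑ ε, swapSign ε * F (swapCoords ε p)

/-- The mixed difference of `h` over the box with corners `a`, `b`: the alternating sum of the
values of `h` at the vertices. It is the transpose of `boxDensity`. -/
def mixedDiff (h : (Fin d → ℝ) → ℝ) : (Fin d → ℝ) × (Fin d → ℝ) → ℝ :=
  alternation fun p => h p.1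

/-- The density `g` with `T_d c (x) = ∫_{[0,x]} g`. The sum over faces that arises on differentiating
`T_d c` is written as one integral of the antisymmetric extension of `c` from the ordered pairs to
all pairs of points of the cube. -/
noncomputable def boxDensity (c : (Fin d → ℝ) × (Fin d → ℝ) → ℝ) (t : Fin d → ℝ) : ℝ :=
  ∫ u, alternation ((orderedPairs d).indicator c) (t, u) ∂cubeMeasure d

lemma alternation_swapCoords (F : (Fin d → ℝ) × (Fin d → ℝ) → ℝ) (δ : Fin d → Bool)
    (p : (Fin d → ℝ) × (Fin d → ℝ)) :
    alternation F (swapCoords δ p) = swapSign δ * alternation F p := by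
  have hinv : Function.Involutive fun (ε : Fin d → Bool) j => xor (ε j) (δ j) := by
    intro ε; ext j; simp
  rw [alternation, alternation, ← Equiv.sum_comp (Function.Involutive.toPerm _ hinv), Finset.mul_sum]
  refine Finset.sum_congr rfl fun ε _ => ?_
  have h1 : swapCoords (Function.Involutive.toPerm _ hinv ε) (swapCoords δ p) = swapCoords ε p := by
    rw [swapCoords_swapCoords]; congr 1; ext j; simp
  rw [h1]
  simp only [Function.Involutive.coe_toPerm]
  rw [swapSign_xor]
  ring

lemma memLp_swapCoords {q : ℝ≥0∞} {F : (Fin d → ℝ) × (Fin d → ℝ) → ℝ}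
    (hF : MemLp F q ((cubeMeasure d).prod (cubeMeasure d))) (ε : Fin d → Bool) :
    MemLp (fun p => F (swapCoords ε p)) q ((cubeMeasure d).prod (cubeMeasure d)) :=
  hF.comp_measurePreserving (measurePreserving_swapCoords ε)

lemma alternation_eq_sum (F : (Fin d → ℝ) × (Fin d → ℝ) → ℝ) :
    alternation F = ∑ ε, fun p => swapSign ε * F (swapCoords ε p) := by
  ext p; simp [alternation]

lemma memLp_alternation {q : ℝ≥0∞} {F : (Fin d → ℝ) × (Fin d → ℝ) → ℝ}
    (hF : MemLp F q ((cubeMeasure d).prod (cubeMeasure d))) :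
    MemLp (alternation F) q ((cubeMeasure d).prod (cubeMeasure d)) := by
  rw [alternation_eq_sum]
  exact memLp_finsetSum' _ fun ε _ => (memLp_swapCoords hF ε).const_mul _

lemma eLpNorm_alternation_le {q : ℝ≥0∞} (hq : 1 ≤ q) {F : (Fin d → ℝ) × (Fin d → ℝ) → ℝ}
    (hF : MemLp F q ((cubeMeasure d).prod (cubeMeasure d))) :
    eLpNorm (alternation F) q ((cubeMeasure d).prod (cubeMeasure d)) ≤
      2 ^ d * eLpNorm F q ((cubeMeasure d).prod (cubeMeasure d)) := by
  rw [alternation_eq_sum]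
  refine (eLpNorm_sum_le
    (fun ε _ => ((memLp_swapCoords hF ε).const_mul _).aestronglyMeasurable) hq).trans ?_
  have h (ε : Fin d → Bool) :
      eLpNorm (fun p => swapSign ε * F (swapCoords ε p)) q
        ((cubeMeasure d).prod (cubeMeasure d)) =
      eLpNorm F q ((cubeMeasure d).prod (cubeMeasure d)) := by
    rw [← eLpNorm_comp_measurePreserving hF.aestronglyMeasurable
      (measurePreserving_swapCoords ε)]
    refine eLpNorm_congr_norm_ae (.of_forall fun p => ?_)
    simp [abs_swapSign]
  simp [h]

/-- Alternation is symmetric for the `L²` pairing, because each swap is a measure-preserving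
involution. -/
lemma integral_alternation_mul {p q : ℝ≥0∞} [p.HolderConjugate q]
    {F G : (Fin d → ℝ) × (Fin d → ℝ) → ℝ}
    (hF : MemLp F p ((cubeMeasure d).prod (cubeMeasure d)))
    (hG : MemLp G q ((cubeMeasure d).prod (cubeMeasure d))) :
    ∫ z, alternation F z * G z ∂(cubeMeasure d).prod (cubeMeasure d) =
      ∫ z, F z * alternation G z ∂(cubeMeasure d).prod (cubeMeasure d) := by
  simp only [alternation, Finset.sum_mul, Finset.mul_sum]
  rw [integral_finsetSum, integral_finsetSum]
  · refine Finset.sum_congr rfl fun ε _ => ?_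
    rw [← integral_swapCoords ε]
    refine integral_congr_ae (.of_forall fun z => ?_)
    simp only [swapCoords_self]
    ring
  · intro ε _
    exact hF.integrable_mul ((memLp_swapCoords hG ε).const_mul _)
  · intro ε _
    exact ((memLp_swapCoords hF ε).const_mul _).integrable_mul hG

/-- Antisymmetrising the restriction of an antisymmetric function to the ordered pairs recovers
the function. -/
lemma alternation_indicator_alternation (F : (Fin d → ℝ) × (Fin d → ℝ) → ℝ) :
    alternation ((orderedPairs d).indicator (alternation F))
      =ᵐ[(cubeMeasure d).prod (cubeMeasure d)] alternation F := by
  filter_upwards [sum_indicator_orderedPairs_swapCoords (d := d)] with p hp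
  calc alternation ((orderedPairs d).indicator (alternation F)) p
      = ∑ ε, (orderedPairs d).indicator (fun _ => (1 : ℝ)) (swapCoords ε p) * alternation F p := by
        refine Finset.sum_congr rfl fun ε _ => ?_
        by_cases h : swapCoords ε p ∈ orderedPairs d
        · rw [indicator_of_mem h, indicator_of_mem h, alternation_swapCoords, ← mul_assoc,
            swapSign_mul_self]
        · rw [indicator_of_notMem h, indicator_of_notMem h]; simp
    _ = alternation F p := by rw [← Finset.sum_mul, hp, one_mul]

/-! ### Averaging over one factor of a product -/

/-- Integrating out the second variable is a contraction of `L_q`: it is a conditional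
expectation. -/
lemma eLpNorm_integral_snd_le {α β : Type*} [MeasurableSpace α] [MeasurableSpace β]
    {μ : Measure α} {ν : Measure β} [IsProbabilityMeasure μ] [IsProbabilityMeasure ν]
    {q : ℝ≥0∞} (hq : 1 ≤ q) {F : α × β → ℝ} (hF : MemLp F q (μ.prod ν)) :
    eLpNorm (fun t => ∫ u, F (t, u) ∂ν) q μ ≤ eLpNorm F q (μ.prod ν) := by
  have hint : Integrable F (μ.prod ν) := hF.integrable hq
  have hG : Integrable (fun t => ∫ u, F (t, u) ∂ν) μ := hint.integral_prod_left
  have hG' : Integrable (fun z : α × β => ∫ u, F (z.1, u) ∂ν) (μ.prod ν) := hG.comp_fst ν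
  have key : (fun z : α × β => ∫ u, F (z.1, u) ∂ν) =ᵐ[μ.prod ν]
      (μ.prod ν)[F | MeasurableSpace.comap Prod.fst inferInstance] := by
    refine ae_eq_condExp_of_forall_setIntegral_eq measurable_fst.comap_le hint (fun _ _ _ => hG'.integrableOn) ?_ ?_
    · rintro _ ⟨s, hs, rfl⟩ -
      have hs' : (Prod.fst ⁻¹' s : Set (α × β)) = s ×ˢ univ := by ext; simp
      rw [hs', setIntegral_prod _ hG'.integrableOn, setIntegral_prod _ hint.integrableOn]
      simp
    · obtain ⟨G, hGm, hGe⟩ := hG.aestronglyMeasurable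
      refine ⟨fun z => G z.1, ?_, ?_⟩
      · exact hGm.comp_measurable (comap_measurable _)
      · exact (measurePreserving_fst (μ := μ) (ν := ν)).quasiMeasurePreserving.ae_eq_comp hGe
  calc eLpNorm (fun t => ∫ u, F (t, u) ∂ν) q μ
      = eLpNorm (fun z : α × β => ∫ u, F (z.1, u) ∂ν) q (μ.prod ν) :=
        (eLpNorm_comp_measurePreserving hG.aestronglyMeasurable
          (measurePreserving_fst (μ := μ) (ν := ν))).symm
    _ = eLpNorm ((μ.prod ν)[F | MeasurableSpace.comap Prod.fst inferInstance]) q (μ.prod ν) :=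
        eLpNorm_congr_ae key
    _ ≤ eLpNorm F q (μ.prod ν) := eLpNorm_condExp_le_eLpNorm F hq

lemma memLp_integral_snd {α β : Type*} [MeasurableSpace α] [MeasurableSpace β]
    {μ : Measure α} {ν : Measure β} [IsProbabilityMeasure μ] [IsProbabilityMeasure ν]
    {q : ℝ≥0∞} (hq : 1 ≤ q) {F : α × β → ℝ} (hF : MemLp F q (μ.prod ν)) :
    MemLp (fun t => ∫ u, F (t, u) ∂ν) q μ :=
  ⟨(hF.integrable hq).integral_prod_left.aestronglyMeasurable,
    (eLpNorm_integral_snd_le hq hF).trans_lt hF.eLpNorm_lt_top⟩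

/-! ### The density and its transpose -/

lemma memLp_indicator_orderedPairs {q : ℝ≥0∞} {c : (Fin d → ℝ) × (Fin d → ℝ) → ℝ}
    (hc : MemLp c q (volume.restrict (boxDomain d))) :
    MemLp ((orderedPairs d).indicator c) q ((cubeMeasure d).prod (cubeMeasure d)) := by
  rwa [memLp_indicator_iff_restrict measurableSet_orderedPairs, ← volume_restrict_boxDomain]

lemma eLpNorm_indicator_orderedPairs {q : ℝ≥0∞} (c : (Fin d → ℝ) × (Fin d → ℝ) → ℝ) :
    eLpNorm ((orderedPairs d).indicator c) q ((cubeMeasure d).prod (cubeMeasure d)) =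
      eLpNorm c q (volume.restrict (boxDomain d)) := by
  rw [eLpNorm_indicator_eq_eLpNorm_restrict measurableSet_orderedPairs, volume_restrict_boxDomain]

lemma integral_boxDomain_eq (F : (Fin d → ℝ) × (Fin d → ℝ) → ℝ) :
    ∫ z in boxDomain d, F z =
      ∫ z, (orderedPairs d).indicator F z ∂(cubeMeasure d).prod (cubeMeasure d) := by
  rw [volume_restrict_boxDomain, integral_indicator measurableSet_orderedPairs]

lemma memLp_boxDensity {q : ℝ≥0∞} (hq : 1 ≤ q) {c : (Fin d → ℝ) × (Fin d → ℝ) → ℝ}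
    (hc : MemLp c q (volume.restrict (boxDomain d))) : MemLp (boxDensity c) q (cubeMeasure d) :=
  memLp_integral_snd hq (memLp_alternation (memLp_indicator_orderedPairs hc))

lemma eLpNorm_boxDensity_le {q : ℝ≥0∞} (hq : 1 ≤ q) {c : (Fin d → ℝ) × (Fin d → ℝ) → ℝ}
    (hc : MemLp c q (volume.restrict (boxDomain d))) :
    eLpNorm (boxDensity c) q (cubeMeasure d) ≤
      2 ^ d * eLpNorm c q (volume.restrict (boxDomain d)) := by
  rw [← eLpNorm_indicator_orderedPairs]
  exact (eLpNorm_integral_snd_le hq (memLp_alternation (memLp_indicator_orderedPairs hc))).trans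
    (eLpNorm_alternation_le hq (memLp_indicator_orderedPairs hc))

lemma memLp_mixedDiff {q : ℝ≥0∞} {h : (Fin d → ℝ) → ℝ} (hh : MemLp h q (cubeMeasure d)) :
    MemLp (mixedDiff h) q ((cubeMeasure d).prod (cubeMeasure d)) :=
  memLp_alternation (hh.comp_measurePreserving measurePreserving_fst)

lemma memLp_mixedDiff_boxDomain {q : ℝ≥0∞} {h : (Fin d → ℝ) → ℝ}
    (hh : MemLp h q (cubeMeasure d)) :
    MemLp (mixedDiff h) q (volume.restrict (boxDomain d)) := by
  rw [volume_restrict_boxDomain]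
  exact (memLp_mixedDiff hh).restrict _

lemma eLpNorm_mixedDiff_le {q : ℝ≥0∞} (hq : 1 ≤ q) {h : (Fin d → ℝ) → ℝ}
    (hh : MemLp h q (cubeMeasure d)) :
    eLpNorm (mixedDiff h) q (volume.restrict (boxDomain d)) ≤
      2 ^ d * eLpNorm h q (cubeMeasure d) := by
  rw [volume_restrict_boxDomain, ← eLpNorm_comp_measurePreserving hh.aestronglyMeasurable
    (measurePreserving_fst (μ := cubeMeasure d) (ν := cubeMeasure d))]
  exact (eLpNorm_restrict_le _ _ _ _).trans
    (eLpNorm_alternation_le hq (hh.comp_measurePreserving measurePreserving_fst))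

/-- `mixedDiff` is the transpose of `boxDensity`. -/
lemma integral_boxDensity_mul {p q : ℝ≥0∞} [p.HolderConjugate q]
    {c : (Fin d → ℝ) × (Fin d → ℝ) → ℝ} {h : (Fin d → ℝ) → ℝ}
    (hc : MemLp c p (volume.restrict (boxDomain d))) (hh : MemLp h q (cubeMeasure d)) :
    ∫ t, boxDensity c t * h t ∂cubeMeasure d = ∫ z in boxDomain d, c z * mixedDiff h z := by
  have hc' := memLp_indicator_orderedPairs hc
  have hh' : MemLp (fun z : (Fin d → ℝ) × (Fin d → ℝ) => h z.1) q
      ((cubeMeasure d).prod (cubeMeasure d)) := hh.comp_measurePreserving measurePreserving_fst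
  have h1 := integral_alternation_mul hc' hh'
  rw [integral_prod _ (integrable_mul_of_memLp (memLp_alternation hc') hh')] at h1
  simp only [integral_mul_const] at h1
  rw [integral_boxDomain_eq]
  refine h1.trans (integral_congr_ae (.of_forall fun z => ?_))
  by_cases hz : z ∈ orderedPairs d <;> simp [hz, mixedDiff]

/-- The mixed difference of a function that ignores some coordinate vanishes. -/
lemma mixedDiff_eq_zero {h : (Fin d → ℝ) → ℝ} (j : Fin d)
    (hj : ∀ x y : Fin d → ℝ, (∀ i, i ≠ j → x i = y i) → h x = h y)
    (z : (Fin d → ℝ) × (Fin d → ℝ)) : mixedDiff h z = 0 := by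
  set δ : Fin d → Bool := fun i => decide (i = j)
  have h1 : mixedDiff h (swapCoords δ z) = mixedDiff h z := by
    refine Finset.sum_congr rfl fun ε _ => ?_
    congr 1
    refine hj _ _ fun i hi => ?_
    simp [swapCoords, δ, hi]
  have h2 : swapSign δ = -1 := by
    rw [swapSign, Finset.prod_eq_single j] <;> simp +contextual [δ]
  rw [mixedDiff, alternation_swapCoords, h2] at h1
  rw [mixedDiff]
  linarith

/-- On densities of box functions the operator `mixedDiff` is isometric: a density integrates to
zero in each variable separately, so all cross terms of the pairing vanish. -/
lemma integral_mixedDiff_mul_mixedDiff {p q : ℝ≥0∞} [p.HolderConjugate q] (hp : 1 ≤ p) (hq : 1 ≤ q)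
    {c : (Fin d → ℝ) × (Fin d → ℝ) → ℝ} {h : (Fin d → ℝ) → ℝ}
    (hc : MemLp c p (volume.restrict (boxDomain d))) (hh : MemLp h q (cubeMeasure d)) :
    ∫ z in boxDomain d, mixedDiff (boxDensity c) z * mixedDiff h z =
      ∫ t, boxDensity c t * h t ∂cubeMeasure d := by
  have hg := memLp_boxDensity hp hc
  have hg' : MemLp (fun z : (Fin d → ℝ) × (Fin d → ℝ) => boxDensity c z.1) p
      ((cubeMeasure d).prod (cubeMeasure d)) := hg.comp_measurePreserving measurePreserving_fst
  have hh' : MemLp (fun z : (Fin d → ℝ) × (Fin d → ℝ) => h z.1) q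
      ((cubeMeasure d).prod (cubeMeasure d)) := hh.comp_measurePreserving measurePreserving_fst
  have hD := memLp_indicator_orderedPairs (memLp_mixedDiff_boxDomain hg)
  have step1 : ∫ z in boxDomain d, mixedDiff (boxDensity c) z * mixedDiff h z =
      ∫ z, boxDensity c z.1 * mixedDiff h z ∂(cubeMeasure d).prod (cubeMeasure d) := by
    rw [mixedDiff, mixedDiff, ← integral_alternation_mul hg' hh']
    refine Eq.trans ?_ (integral_congr_ae
      ((alternation_indicator_alternation _).mul (ae_eq_refl fun z : (Fin d → ℝ) × (Fin d → ℝ) => h z.1)))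
    refine Eq.trans ?_ (integral_alternation_mul hD hh').symm
    rw [integral_boxDomain_eq]
    refine integral_congr_ae (.of_forall fun z => ?_)
    by_cases hz : z ∈ orderedPairs d <;> simp [hz, mixedDiff]
  -- The term with the swap `ε` pairs the density with an average of `h` over the coordinates
  -- marked by `ε`.
  have step2 (ε : Fin d → Bool) :
      ∫ z, boxDensity c z.1 * h (swapCoords ε z).1 ∂(cubeMeasure d).prod (cubeMeasure d) =
      ∫ z in boxDomain d,
        c z * mixedDiff (fun t => ∫ u, h (swapCoords ε (t, u)).1 ∂cubeMeasure d) z := by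
    have hε := memLp_swapCoords hh' ε
    rw [← integral_boxDensity_mul hc (memLp_integral_snd hq hε),
      integral_prod _ (integrable_mul_of_memLp hg' hε)]
    simp only [integral_const_mul]
  rw [step1]
  simp only [mixedDiff, alternation, Finset.mul_sum]
  rw [integral_finsetSum _ fun ε _ => integrable_mul_of_memLp hg' ((memLp_swapCoords hh' ε).const_mul _)]
  simp only [mul_left_comm (boxDensity c _), integral_const_mul]
  rw [Finset.sum_eq_single fun _ => false]
  · simp only [swapSign_false, swapCoords_false, one_mul]
    rw [integral_prod _ (integrable_mul_of_memLp hg' hh')]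
    simp
  · intro ε _ hε
    obtain ⟨j, hj⟩ : ∃ j, ε j = true := by
      by_contra! hall
      exact hε (funext fun j => by simpa using hall j)
    rw [step2, integral_eq_zero_of_ae, mul_zero]
    refine .of_forall fun z => ?_
    change c z * mixedDiff _ z = 0
    rw [mixedDiff_eq_zero j]
    · simp
    · intro x y hxy
      refine integral_congr_ae (.of_forall fun u => ?_)
      refine congrArg h (funext fun i => ?_)
      rcases eq_or_ne i j with rfl | hi
      · simp [swapCoords, hj]
      · simp [swapCoords, hxy i hi]
  · simp

/-! ### The fundamental theorem of calculus for the mixed derivative -/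

lemma contDiff_partialD {φ : (Fin d → ℝ) → ℝ} (hφ : ContDiff ℝ ∞ φ) (j : Fin d) :
    ContDiff ℝ ∞ (partialD j φ) :=
  (hφ.fderiv_right (m := ∞) (by simp)).clm_apply contDiff_const

lemma tsupport_partialD_subset (φ : (Fin d → ℝ) → ℝ) (j : Fin d) :
    tsupport (partialD j φ) ⊆ tsupport φ := by
  refine closure_minimal (fun x hx => ?_) (isClosed_tsupport φ)
  refine support_fderiv_subset ℝ (f := φ) ?_
  intro h
  exact hx (by simp [partialD, h])

lemma contDiff_foldr_partialD {φ : (Fin d → ℝ) → ℝ} (hφ : ContDiff ℝ ∞ φ) (l : List (Fin d)) :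
    ContDiff ℝ ∞ (l.foldr partialD φ) := by
  induction l with
  | nil => exact hφ
  | cons j l ih => exact contDiff_partialD ih j

lemma tsupport_foldr_partialD_subset (φ : (Fin d → ℝ) → ℝ) (l : List (Fin d)) :
    tsupport (l.foldr partialD φ) ⊆ tsupport φ := by
  induction l with
  | nil => exact subset_rfl
  | cons j l ih => exact (tsupport_partialD_subset _ j).trans ih

lemma hasCompactSupport_foldr_partialD {φ : (Fin d → ℝ) → ℝ} (hφ : HasCompactSupport φ)
    (l : List (Fin d)) : HasCompactSupport (l.foldr partialD φ) :=
  hφ.of_isClosed_subset (isClosed_tsupport _) (tsupport_foldr_partialD_subset φ l)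

lemma contDiff_cons_left (y : Fin d → ℝ) :
    ContDiff ℝ ∞ fun s : ℝ => (Fin.cons s y : Fin (d + 1) → ℝ) := by
  refine contDiff_pi.2 fun i => ?_
  refine Fin.cases ?_ (fun j => ?_) i
  · simp only [Fin.cons_zero]; exact contDiff_id
  · simpa using contDiff_const

lemma contDiff_cons_right (s : ℝ) :
    ContDiff ℝ ∞ fun y : Fin d → ℝ => (Fin.cons s y : Fin (d + 1) → ℝ) := by
  refine contDiff_pi.2 fun i => ?_
  refine Fin.cases ?_ (fun j => ?_) i
  · simpa using contDiff_const
  · simpa using contDiff_apply ℝ ℝ j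

lemma hasCompactSupport_comp_cons_left {ψ : (Fin (d + 1) → ℝ) → ℝ} (hψ : HasCompactSupport ψ)
    (y : Fin d → ℝ) : HasCompactSupport fun s : ℝ => ψ (Fin.cons s y) := by
  refine hψ.comp_isClosedEmbedding (Function.LeftInverse.isClosedEmbedding
    (f := fun x : Fin (d + 1) → ℝ => x 0) (fun s => ?_) (by fun_prop)
    (contDiff_cons_left y).continuous)
  simp

lemma hasCompactSupport_comp_cons_right {ψ : (Fin (d + 1) → ℝ) → ℝ} (hψ : HasCompactSupport ψ)
    (s : ℝ) : HasCompactSupport fun y : Fin d → ℝ => ψ (Fin.cons s y) := by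
  refine hψ.comp_isClosedEmbedding (Function.LeftInverse.isClosedEmbedding
    (f := fun x : Fin (d + 1) → ℝ => fun j : Fin d => x j.succ) (fun y => ?_) (by fun_prop)
    (contDiff_cons_right s).continuous)
  simp

lemma hasDerivAt_cons_left {ψ : (Fin (d + 1) → ℝ) → ℝ} (hψ : ContDiff ℝ ∞ ψ) (y : Fin d → ℝ)
    (s : ℝ) : HasDerivAt (fun s : ℝ => ψ (Fin.cons s y)) (partialD 0 ψ (Fin.cons s y)) s := by
  have h1 : HasDerivAt (fun s : ℝ => (Fin.cons s y : Fin (d + 1) → ℝ)) (Pi.single 0 1) s := by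
    refine hasDerivAt_pi.2 fun i => ?_
    refine Fin.cases ?_ (fun j => ?_) i
    · simp only [Fin.cons_zero, Pi.single_eq_same]; exact hasDerivAt_id s
    · simpa using hasDerivAt_const s (y j)
  exact ((hψ.differentiable (by simp)).differentiableAt.hasFDerivAt).comp_hasDerivAt s h1

lemma partialD_comp_cons {ψ : (Fin (d + 1) → ℝ) → ℝ} (hψ : ContDiff ℝ ∞ ψ) (s : ℝ) (j : Fin d)
    (y : Fin d → ℝ) :
    partialD j (fun y => ψ (Fin.cons s y)) y = partialD j.succ ψ (Fin.cons s y) := by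
  have h1 : HasDerivAt (fun r : ℝ => y + r • (Pi.single j 1 : Fin d → ℝ)) (Pi.single j 1) 0 := by
    simpa using ((hasDerivAt_id (0 : ℝ)).smul_const (Pi.single j 1 : Fin d → ℝ)).const_add y
  have h2 : HasDerivAt (fun r : ℝ => (Fin.cons s y : Fin (d + 1) → ℝ) +
      r • (Pi.single j.succ 1 : Fin (d + 1) → ℝ)) (Pi.single j.succ 1) 0 := by
    simpa using ((hasDerivAt_id (0 : ℝ)).smul_const
      (Pi.single j.succ 1 : Fin (d + 1) → ℝ)).const_add (Fin.cons s y)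
  have hcons (r : ℝ) : (Fin.cons s (y + r • (Pi.single j 1 : Fin d → ℝ)) : Fin (d + 1) → ℝ) =
      Fin.cons s y + r • Pi.single j.succ 1 := by
    ext i
    refine Fin.cases ?_ (fun k => ?_) i
    · simp
    · simp [Pi.single_apply]
  have hχ : Differentiable ℝ fun y : Fin d → ℝ => ψ (Fin.cons s y) :=
    (hψ.comp (contDiff_cons_right s)).differentiable (by simp)
  have d1 := HasFDerivAt.comp_hasDerivAt_of_eq (0 : ℝ) (hχ y).hasFDerivAt h1 (by simp)
  have d2 := HasFDerivAt.comp_hasDerivAt_of_eq (0 : ℝ)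
    ((hψ.differentiable (by simp)) (Fin.cons s y)).hasFDerivAt h2 (by simp)
  have he : (fun y : Fin d → ℝ => ψ (Fin.cons s y)) ∘
      (fun r : ℝ => y + r • (Pi.single j 1 : Fin d → ℝ)) =
      ψ ∘ fun r : ℝ => (Fin.cons s y : Fin (d + 1) → ℝ) + r • Pi.single j.succ 1 := by
    ext r; simp [hcons]
  rw [he] at d1
  exact d1.unique d2

lemma foldr_partialD_map_succ {φ : (Fin (d + 1) → ℝ) → ℝ} (hφ : ContDiff ℝ ∞ φ) (s : ℝ)
    (l : List (Fin d)) :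
    (fun y => (l.map Fin.succ).foldr partialD φ (Fin.cons s y)) =
      l.foldr partialD fun y => φ (Fin.cons s y) := by
  induction l with
  | nil => rfl
  | cons j l ih =>
    rw [List.foldr_cons, ← ih]
    ext y
    exact (partialD_comp_cons (contDiff_foldr_partialD hφ _) s j y).symm

/-- Integrating `∂_1 ⋯ ∂_d φ` over the orthant with corner `t` recovers `φ(t)` up to sign. -/
lemma integral_Ici_classicalMixedD : ∀ {d : ℕ} {φ : (Fin d → ℝ) → ℝ}, ContDiff ℝ ∞ φ →
    HasCompactSupport φ → ∀ t : Fin d → ℝ,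
      ∫ x in Ici t, classicalMixedD φ x = (-1) ^ d * φ t
  | 0, φ, _, _, t => by
    have h : Ici t = univ := by ext x; simp [Subsingleton.elim x t]
    rw [h, volume_pi, Measure.pi_of_empty _ t]
    simp [classicalMixedD]
  | d + 1, φ, hφ, hc, t => by
    set ψ := ((List.finRange d).map Fin.succ).foldr partialD φ
    have hψ : ContDiff ℝ ∞ ψ := contDiff_foldr_partialD hφ _
    have hψc : HasCompactSupport ψ := hasCompactSupport_foldr_partialD hc _
    have hD : classicalMixedD φ = partialD 0 ψ := by
      rw [classicalMixedD, List.finRange_succ]; rfl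
    have hDi : Integrable (partialD 0 ψ) :=
      (contDiff_partialD hψ 0).continuous.integrable_of_hasCompactSupport
        (hψc.of_isClosed_subset (isClosed_tsupport _) (tsupport_partialD_subset ψ 0))
    let e := (MeasurableEquiv.piFinSuccAbove (fun _ : Fin (d + 1) => ℝ) 0).symm
    have he : MeasurePreserving e :=
      (volume_preserving_piFinSuccAbove (fun _ : Fin (d + 1) => ℝ) 0).symm _
    have he_apply (z : ℝ × (Fin d → ℝ)) : e z = Fin.cons z.1 z.2 := by
      simp [e, MeasurableEquiv.piFinSuccAbove]; rfl
    have hpre : e ⁻¹' Ici t = Ici (t 0) ×ˢ Ici (Fin.tail t) := by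
      ext z
      simp only [mem_preimage, mem_Ici, mem_prod, he_apply, Pi.le_def, Fin.forall_fin_succ,
        Fin.cons_zero, Fin.cons_succ, Fin.tail]
    have hint : IntegrableOn (fun z => partialD 0 ψ (e z)) (Ici (t 0) ×ˢ Ici (Fin.tail t)) :=
      (he.integrable_comp_of_integrable hDi).integrableOn
    rw [hD, ← he.setIntegral_preimage_emb e.measurableEmbedding, hpre]
    rw [Measure.volume_eq_prod, IntegrableOn, ← Measure.prod_restrict] at hint
    rw [Measure.volume_eq_prod, ← Measure.prod_restrict, integral_prod_symm _ hint]
    have hinner (y : Fin d → ℝ) :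
        ∫ s in Ici (t 0), partialD 0 ψ (e (s, y)) = -ψ (Fin.cons (t 0) y) := by
      rw [integral_Ici_eq_integral_Ioi]
      have := (hasCompactSupport_comp_cons_left hψc y).integral_Ioi_deriv_eq
        ((hψ.comp (contDiff_cons_left y)).of_le (by simp)) (t 0)
      simp only [Function.comp_def, (hasDerivAt_cons_left hψ y _).deriv] at this
      simpa only [he_apply] using this
    simp only [hinner, integral_neg]
    have hψ' : (fun y => ψ (Fin.cons (t 0) y)) =
        classicalMixedD fun y => φ (Fin.cons (t 0) y) := foldr_partialD_map_succ hφ _ _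
    have ih := integral_Ici_classicalMixedD (hφ.comp (contDiff_cons_right (t 0)))
      (hasCompactSupport_comp_cons_right hc (t 0)) (Fin.tail t)
    simp only [Function.comp_def, Fin.cons_self_tail] at ih
    rw [hψ', ih]
    ring

/-! ### Weak mixed derivatives -/

lemma integrable_mul_indicator_Iic {g : (Fin d → ℝ) → ℝ} (hg : Integrable g (cubeMeasure d))
    {ψ : (Fin d → ℝ) → ℝ} (hψ : Integrable ψ (cubeMeasure d)) :
    Integrable (fun z : (Fin d → ℝ) × (Fin d → ℝ) =>
      ψ z.1 * (g z.2 * (Iic z.1).indicator (fun _ => (1 : ℝ)) z.2))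
      ((cubeMeasure d).prod (cubeMeasure d)) := by
  have hm : MeasurableSet {z : (Fin d → ℝ) × (Fin d → ℝ) | z.2 ≤ z.1} :=
    (isClosed_le continuous_snd continuous_fst).measurableSet
  refine ((hψ.mul_prod hg).indicator hm).congr (.of_forall fun z => ?_)
  by_cases hz : z.2 ≤ z.1 <;> simp [hz]

/-- The primitive `x ↦ ∫_{[0,x]} g` has weak mixed derivative `g`. -/
lemma isWeakMixedDeriv_of_eqOn {f g : (Fin d → ℝ) → ℝ} (hg : Integrable g (cubeMeasure d))
    (hf : ∀ x ∈ unitCube d,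
      f x = ∫ t, g t * (Iic x).indicator (fun _ => (1 : ℝ)) t ∂cubeMeasure d) :
    IsWeakMixedDeriv d f g := by
  have hfae : ∀ᵐ x ∂cubeMeasure d,
      (∫ t, g t * (Iic x).indicator (fun _ => (1 : ℝ)) t ∂cubeMeasure d) = f x := by
    filter_upwards [ae_restrict_mem measurableSet_unitCube] with x hx using (hf x hx).symm
  refine ⟨?_, ?_, fun φ hφ hφc hφs => ?_⟩
  · refine IntegrableOn.locallyIntegrableOn ?_
    rw [IntegrableOn, ← cubeMeasure_eq_openCube]
    have := (integrable_mul_indicator_Iic hg (integrable_const 1)).integral_prod_left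
    simp only [one_mul] at this
    exact this.congr hfae
  · refine IntegrableOn.locallyIntegrableOn ?_
    rwa [IntegrableOn, ← cubeMeasure_eq_openCube]
  · have hDs : tsupport (classicalMixedD φ) ⊆ openCube d :=
      (tsupport_foldr_partialD_subset φ _).trans hφs
    have hDi : Integrable (classicalMixedD φ) :=
      (contDiff_foldr_partialD hφ _).continuous.integrable_of_hasCompactSupport
        (hasCompactSupport_foldr_partialD hφc _)
    have hint := integrable_mul_indicator_Iic hg (hDi.restrict (s := unitCube d))
    have hinner (t : Fin d → ℝ) : ∫ x, classicalMixedD φ x *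
        (g t * (Iic x).indicator (fun _ => (1 : ℝ)) t) ∂cubeMeasure d
          = (-1) ^ d * (g t * φ t) := by
      calc ∫ x, classicalMixedD φ x *
          (g t * (Iic x).indicator (fun _ => (1 : ℝ)) t) ∂cubeMeasure d
          = ∫ x in openCube d, g t * (Ici t).indicator (classicalMixedD φ) x := by
            rw [cubeMeasure_eq_openCube]
            refine integral_congr_ae (.of_forall fun x => ?_)
            by_cases hx : t ≤ x <;> simp [hx, mul_comm]
        _ = ∫ x, g t * (Ici t).indicator (classicalMixedD φ) x := by
            refine setIntegral_eq_integral_of_forall_compl_eq_zero fun x hx => ?_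
            have : classicalMixedD φ x = 0 := image_eq_zero_of_notMem_tsupport fun h => hx (hDs h)
            simp [this]
        _ = (-1) ^ d * (g t * φ t) := by
            rw [integral_const_mul, integral_indicator measurableSet_Ici,
              integral_Ici_classicalMixedD hφ hφc]
            ring
    rw [← cubeMeasure_eq_openCube, ← integral_const_mul]
    simp only [← hinner]
    rw [← integral_prod_symm _ hint, integral_prod _ hint]
    refine integral_congr_ae ?_
    filter_upwards [hfae] with x hx
    simp only [integral_const_mul]
    rw [← hx, mul_comm]

lemma IsWeakMixedDeriv.ae_eq {f g g' : (Fin d → ℝ) → ℝ} (hg : IsWeakMixedDeriv d f g)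
    (hg' : IsWeakMixedDeriv d f g') : g =ᵐ[cubeMeasure d] g' := by
  have key : ∀ᵐ x ∂(volume : Measure (Fin d → ℝ)), x ∈ openCube d → (g - g') x = 0 := by
    refine isOpen_openCube.ae_eq_zero_of_integral_contDiff_smul_eq_zero
      (hg.2.1.sub hg'.2.1) fun φ hφ hφc hφs => ?_
    have hint {k : (Fin d → ℝ) → ℝ} (hk : LocallyIntegrableOn k (openCube d)) :
        IntegrableOn (fun x => k x * φ x) (openCube d) := by
      have h1 := (hk.integrableOn_compact_subset hφs hφc).mul_continuousOn
        hφ.continuous.continuousOn hφc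
      refine Integrable.integrableOn ?_
      refine (integrableOn_iff_integrable_of_support_subset ?_).1 h1
      exact (Function.support_mul_subset_right _ _).trans (subset_tsupport φ)
    have h := (hg.2.2 φ hφ hφc hφs).symm.trans (hg'.2.2 φ hφ hφc hφs)
    have h' := mul_left_cancel₀ (pow_ne_zero d (by norm_num)) h
    rw [← setIntegral_eq_integral_of_forall_compl_eq_zero (s := openCube d) fun x hx => by
      rw [image_eq_zero_of_notMem_tsupport fun h => hx (hφs h), zero_smul]]
    calc ∫ x in openCube d, φ x • (g - g') x
        = ∫ x in openCube d, (g x * φ x - g' x * φ x) := by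
          refine integral_congr_ae (.of_forall fun x => ?_)
          simp only [Pi.sub_apply, smul_eq_mul]
          ring
      _ = 0 := by rw [integral_sub (hint hg.2.1) (hint hg'.2.1), h', sub_self]
  rw [cubeMeasure_eq_openCube]
  refine (ae_restrict_iff' isOpen_openCube.measurableSet).2 ?_
  filter_upwards [key] with x hx hxU
  exact sub_eq_zero.1 (hx hxU)

/-! ### Representers and norms -/

/-- On ordered pairs the indicator of the box `[a, b)` at `x` is the mixed difference, over the box,
of the indicator of the orthant below `x`. -/
lemma boxIndicator_eq_mixedDiff {z : (Fin d → ℝ) × (Fin d → ℝ)} (hz : z.1 ≤ z.2)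
    (x : Fin d → ℝ) :
    boxIndicator z.1 z.2 x = mixedDiff ((Iic x).indicator fun _ => (1 : ℝ)) z := by
  have h (ε : Fin d → Bool) :
      swapSign ε * (Iic x).indicator (fun _ => (1 : ℝ)) (swapCoords ε z).1 =
      ∏ j, if ε j then (if z.2 j ≤ x j then -1 else 0) else (if z.1 j ≤ x j then 1 else 0) := by
    by_cases hm : (swapCoords ε z).1 ≤ x
    · rw [indicator_of_mem (by exact hm), mul_one, swapSign]
      refine Finset.prod_congr rfl fun j _ => ?_
      have := hm j
      cases hε : ε j <;> simp_all [swapCoords]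
    · rw [indicator_of_notMem (by exact hm), mul_zero]
      simp only [Pi.le_def, not_forall] at hm
      obtain ⟨j, hj⟩ := hm
      refine (Finset.prod_eq_zero (Finset.mem_univ j) ?_).symm
      cases hε : ε j <;> simp_all [swapCoords]
  simp only [mixedDiff, alternation, h]
  rw [← Fintype.prod_sum (fun j (e : Bool) => if e then (if z.2 j ≤ x j then (-1 : ℝ) else 0)
    else (if z.1 j ≤ x j then 1 else 0)), boxIndicator]
  refine Finset.prod_congr rfl fun j _ => ?_
  have hj := hz j
  by_cases h1 : z.1 j ≤ x j
  · by_cases h2 : z.2 j ≤ x j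
    · simp [indicator, h1, h2, h2.not_gt]
    · simp [indicator, h1, h2, lt_of_not_ge h2]
  · have h2 : ¬ z.2 j ≤ x j := fun h => h1 (hj.trans h)
    simp [indicator, h1, h2]

lemma boxOperator_eq_integral_mixedDiff (c : (Fin d → ℝ) × (Fin d → ℝ) → ℝ) (x : Fin d → ℝ) :
    boxOperator d c x =
      ∫ z in boxDomain d, c z * mixedDiff ((Iic x).indicator fun _ => (1 : ℝ)) z := by
  rw [boxOperator, integral_boxDomain_eq, integral_boxDomain_eq]
  congr 1
  ext z
  by_cases hz : z ∈ orderedPairs d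
  · simp [hz, boxIndicator_eq_mixedDiff (show z.1 ≤ z.2 from hz)]
  · simp [hz]

lemma memLp_indicator_Iic (x : Fin d → ℝ) (p : ℝ≥0∞) :
    MemLp ((Iic x).indicator fun _ => (1 : ℝ)) p (cubeMeasure d) :=
  memLp_indicator_const p measurableSet_Iic 1 (.inr (measure_ne_top _ _))

lemma isFiniteMeasure_boxDomain :
    IsFiniteMeasure ((volume : Measure ((Fin d → ℝ) × (Fin d → ℝ))).restrict (boxDomain d)) := by
  rw [volume_restrict_boxDomain]; infer_instance

lemma boxOperator_eq_integral_boxDensity {c : (Fin d → ℝ) × (Fin d → ℝ) → ℝ}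
    (hc : MemLp c 1 (volume.restrict (boxDomain d))) (x : Fin d → ℝ) :
    boxOperator d c x =
      ∫ t, boxDensity c t * (Iic x).indicator (fun _ => (1 : ℝ)) t ∂cubeMeasure d := by
  rw [boxOperator_eq_integral_mixedDiff,
    integral_boxDensity_mul (q := ∞) hc (memLp_indicator_Iic x ∞)]

/-- The mixed difference of the density of `T_d c` represents the same function as `c`; it is the
representer of minimal `L_2` norm. -/
lemma boxOperator_mixedDiff_boxDensity {c : (Fin d → ℝ) × (Fin d → ℝ) → ℝ}
    (hc : MemLp c 1 (volume.restrict (boxDomain d))) (x : Fin d → ℝ) :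
    boxOperator d (mixedDiff (boxDensity c)) x = boxOperator d c x := by
  rw [boxOperator_eq_integral_mixedDiff, boxOperator_eq_integral_boxDensity hc,
    integral_mixedDiff_mul_mixedDiff (q := ∞) le_rfl le_top hc (memLp_indicator_Iic x ∞)]

lemma IsRepresenter.memLp_one {q : ℝ≥0∞} (hq : 1 ≤ q) {f : (Fin d → ℝ) → ℝ}
    {c : (Fin d → ℝ) × (Fin d → ℝ) → ℝ} (h : IsRepresenter d q f c) :
    MemLp c 1 (volume.restrict (boxDomain d)) :=
  have := isFiniteMeasure_boxDomain (d := d)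
  h.1.mono_exponent hq

lemma IsRepresenter.mixedDiff_boxDensity {q : ℝ≥0∞} (hq : 1 ≤ q) {f : (Fin d → ℝ) → ℝ}
    {c : (Fin d → ℝ) × (Fin d → ℝ) → ℝ} (h : IsRepresenter d q f c) :
    IsRepresenter d q f (mixedDiff (boxDensity c)) :=
  ⟨memLp_mixedDiff_boxDomain (memLp_boxDensity hq h.1), fun x hx => by
    rw [boxOperator_mixedDiff_boxDensity (h.memLp_one hq), h.2 hx]⟩

lemma IsRepresenter.isWeakMixedDeriv_boxDensity {q : ℝ≥0∞} (hq : 1 ≤ q) {f : (Fin d → ℝ) → ℝ}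
    {c : (Fin d → ℝ) × (Fin d → ℝ) → ℝ} (h : IsRepresenter d q f c) :
    IsWeakMixedDeriv d f (boxDensity c) :=
  isWeakMixedDeriv_of_eqOn ((memLp_boxDensity hq h.1).integrable hq) fun x hx => by
    rw [h.2 hx, boxOperator_eq_integral_boxDensity (h.memLp_one hq)]

lemma isWeakMixedDeriv_weakMixedDeriv {f g : (Fin d → ℝ) → ℝ} (h : IsWeakMixedDeriv d f g) :
    IsWeakMixedDeriv d f (weakMixedDeriv d f) := by
  have hex : ∃ g, IsWeakMixedDeriv d f g := ⟨g, h⟩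
  rw [weakMixedDeriv, dif_pos hex]
  exact hex.choose_spec

lemma IsRepresenter.weakMixedDeriv_ae_eq {q : ℝ≥0∞} (hq : 1 ≤ q) {f : (Fin d → ℝ) → ℝ}
    {c : (Fin d → ℝ) × (Fin d → ℝ) → ℝ} (h : IsRepresenter d q f c) :
    weakMixedDeriv d f =ᵐ[cubeMeasure d] boxDensity c :=
  (isWeakMixedDeriv_weakMixedDeriv (h.isWeakMixedDeriv_boxDensity hq)).ae_eq
    (h.isWeakMixedDeriv_boxDensity hq)

lemma IsRepresenter.mixNorm_eq {q : ℝ≥0∞} (hq : 1 ≤ q) {f : (Fin d → ℝ) → ℝ}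
    {c : (Fin d → ℝ) × (Fin d → ℝ) → ℝ} (h : IsRepresenter d q f c) :
    mixNorm d q f = (eLpNorm (boxDensity c) q (cubeMeasure d)).toReal :=
  congrArg ENNReal.toReal (eLpNorm_congr_ae (h.weakMixedDeriv_ae_eq hq))

lemma IsRepresenter.boxNorm_le {q : ℝ≥0∞} {f : (Fin d → ℝ) → ℝ}
    {c : (Fin d → ℝ) × (Fin d → ℝ) → ℝ} (h : IsRepresenter d q f c) :
    boxNorm d q f ≤ (eLpNorm c q (volume.restrict (boxDomain d))).toReal := by
  refine csInf_le ⟨0, ?_⟩ ⟨c, h, rfl⟩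
  rintro _ ⟨c', -, rfl⟩
  exact ENNReal.toReal_nonneg

lemma le_boxNorm {q : ℝ≥0∞} {f : (Fin d → ℝ) → ℝ} (hf : f ∈ boxSpace d q) {r : ℝ}
    (hr : ∀ c, IsRepresenter d q f c →
      r ≤ (eLpNorm c q (volume.restrict (boxDomain d))).toReal) : r ≤ boxNorm d q f := by
  obtain ⟨c, hc⟩ := hf
  refine le_csInf ⟨_, c, hc, rfl⟩ ?_
  rintro _ ⟨c', hc', rfl⟩
  exact hr c' hc'

lemma IsRepresenter.mixNorm_le {q : ℝ≥0∞} (hq : 1 ≤ q) {f : (Fin d → ℝ) → ℝ}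
    {c : (Fin d → ℝ) × (Fin d → ℝ) → ℝ} (h : IsRepresenter d q f c) :
    mixNorm d q f ≤ 2 ^ d * (eLpNorm c q (volume.restrict (boxDomain d))).toReal := by
  have := ENNReal.toReal_mono (ENNReal.mul_ne_top (by simp) h.1.eLpNorm_ne_top)
    (eLpNorm_boxDensity_le hq h.1)
  rw [h.mixNorm_eq hq]
  simpa using this

lemma boxNorm_le_two_pow_mul_mixNorm {q : ℝ≥0∞} (hq : 1 ≤ q) {f : (Fin d → ℝ) → ℝ}
    (hf : f ∈ boxSpace d q) : boxNorm d q f ≤ 2 ^ d * mixNorm d q f := by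
  obtain ⟨c, hc⟩ := hf
  have hg := memLp_boxDensity hq hc.1
  have := ENNReal.toReal_mono (ENNReal.mul_ne_top (by simp) hg.eLpNorm_ne_top)
    (eLpNorm_mixedDiff_le hq hg)
  refine (hc.mixedDiff_boxDensity hq).boxNorm_le.trans ?_
  rw [hc.mixNorm_eq hq]
  simpa using this

lemma toReal_eLpNorm_two_sq {α : Type*} [MeasurableSpace α] {μ : Measure α} {F : α → ℝ}
    (hF : MemLp F 2 μ) : (eLpNorm F 2 μ).toReal ^ 2 = ∫ z, F z * F z ∂μ := by
  have h0 : 0 ≤ ∫ z, F z * F z ∂μ := integral_nonneg fun z => mul_self_nonneg _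
  rw [hF.eLpNorm_eq_integral_rpow_norm (by simp) (by simp)]
  simp only [ENNReal.toReal_ofNat, Real.rpow_two, Real.norm_eq_abs, sq_abs]
  simp only [pow_two (F _)]
  rw [ENNReal.toReal_ofReal (by positivity), ← Real.rpow_natCast, ← Real.rpow_mul h0]
  norm_num

/-- In `L_2` the representer `mixedDiff (boxDensity c)` has the same norm as the density. -/
lemma toReal_eLpNorm_mixedDiff_boxDensity_two {c : (Fin d → ℝ) × (Fin d → ℝ) → ℝ}
    (hc : MemLp c 2 (volume.restrict (boxDomain d))) :
    (eLpNorm (mixedDiff (boxDensity c)) 2 (volume.restrict (boxDomain d))).toReal =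
      (eLpNorm (boxDensity c) 2 (cubeMeasure d)).toReal := by
  have hg := memLp_boxDensity one_le_two hc
  rw [← pow_left_inj₀ ENNReal.toReal_nonneg ENNReal.toReal_nonneg two_ne_zero,
    toReal_eLpNorm_two_sq (memLp_mixedDiff_boxDomain hg), toReal_eLpNorm_two_sq hg,
    integral_mixedDiff_mul_mixedDiff one_le_two one_le_two hc hg]

/-- In `L_2` the density is no larger than any representer `c`: with `g` the density and `c*` its
mixed difference, `⟨c, c*⟩ = ‖g‖² = ‖c*‖²`, so `‖c‖² - ‖g‖² = ‖c - c*‖² ≥ 0`. -/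
lemma toReal_eLpNorm_boxDensity_two_le {c : (Fin d → ℝ) × (Fin d → ℝ) → ℝ}
    (hc : MemLp c 2 (volume.restrict (boxDomain d))) :
    (eLpNorm (boxDensity c) 2 (cubeMeasure d)).toReal ≤
      (eLpNorm c 2 (volume.restrict (boxDomain d))).toReal := by
  have hg := memLp_boxDensity one_le_two hc
  have hs := memLp_mixedDiff_boxDomain hg
  have h0 : 0 ≤ ∫ z in boxDomain d, (c z - mixedDiff (boxDensity c) z) *
      (c z - mixedDiff (boxDensity c) z) := integral_nonneg fun z => mul_self_nonneg _
  have hexp : ∫ z in boxDomain d, (c z - mixedDiff (boxDensity c) z) *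
      (c z - mixedDiff (boxDensity c) z) =
      (∫ z in boxDomain d, c z * c z) - (∫ z in boxDomain d, c z * mixedDiff (boxDensity c) z) -
      ((∫ z in boxDomain d, c z * mixedDiff (boxDensity c) z) -
        ∫ z in boxDomain d, mixedDiff (boxDensity c) z * mixedDiff (boxDensity c) z) := by
    have h1 := integrable_mul_of_memLp hc hc
    have h2 := integrable_mul_of_memLp hc hs
    have h3 := integrable_mul_of_memLp hs hs
    have h12 : Integrable (fun z => c z * c z - c z * mixedDiff (boxDensity c) z)
        (volume.restrict (boxDomain d)) := h1.sub h2
    have h23 : Integrable (fun z => c z * mixedDiff (boxDensity c) z -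
        mixedDiff (boxDensity c) z * mixedDiff (boxDensity c) z)
        (volume.restrict (boxDomain d)) := h2.sub h3
    rw [← integral_sub h1 h2, ← integral_sub h2 h3, ← integral_sub h12 h23]
    refine integral_congr_ae (.of_forall fun z => ?_)
    ring
  rw [hexp, integral_mixedDiff_mul_mixedDiff one_le_two one_le_two hc hg,
    ← integral_boxDensity_mul hc hg] at h0
  refine (sq_le_sq₀ ENNReal.toReal_nonneg ENNReal.toReal_nonneg).1 ?_
  rw [toReal_eLpNorm_two_sq hc, toReal_eLpNorm_two_sq hg]
  linarith

end

theorem mainTheorem6 (d : ℕ) (hd : 1 ≤ d) (q : ℝ≥0∞) (hq : 1 ≤ q) :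
    (∀ f ∈ boxSpace d q,
      (IsWeakMixedDeriv d f (weakMixedDeriv d f) ∧
        MemLp (weakMixedDeriv d f) q (volume.restrict (unitCube d))) ∧
      (2 : ℝ) ^ (-(d : ℤ)) * mixNorm d q f ≤ boxNorm d q f ∧
      boxNorm d q f ≤ (2 : ℝ) ^ d * mixNorm d q f) ∧
    (q = 2 → ∀ f ∈ boxSpace d q, boxNorm d q f = mixNorm d q f) := by
  refine ⟨fun f hf => ⟨?_, ?_, boxNorm_le_two_pow_mul_mixNorm hq hf⟩, ?_⟩
  · obtain ⟨c, hc⟩ := hf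
    exact ⟨isWeakMixedDeriv_weakMixedDeriv (hc.isWeakMixedDeriv_boxDensity hq),
      (memLp_congr_ae (hc.weakMixedDeriv_ae_eq hq)).2 (memLp_boxDensity hq hc.1)⟩
  · refine le_boxNorm hf fun c hc => ?_
    rw [zpow_neg, zpow_natCast, inv_mul_le_iff₀ (by positivity)]
    exact hc.mixNorm_le hq
  · rintro rfl f hf
    refine le_antisymm ?_ (le_boxNorm hf fun c hc => ?_)
    · obtain ⟨c, hc⟩ := hf
      refine (hc.mixedDiff_boxDensity hq).boxNorm_le.trans_eq ?_
      rw [toReal_eLpNorm_mixedDiff_boxDensity_two hc.1, hc.mixNorm_eq hq]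
    · rw [hc.mixNorm_eq hq]
      exact toReal_eLpNorm_boxDensity_two_le hc.1
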